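/- Let $r\ge 2$ and $n\ge 1$ be integers, let $G$ be a simple graph of order $n$ containing no complete graph $K_{r+1}$, and let $\alpha$ be a real number. For a graph $H$ with adjacency matrix $A(H)$ and diagonal degree matrix $D(H)$ put $A_\alpha(H)=\alpha D(H)+(1-\alpha)A(H)$, and let $\lambda(M)$ denote the largest eigenvalue of a real symmetric matrix $M$. Let $T_r(n)$ be the $r$-partite Turán graph of order $n$, that is, the complete multipartite graph whose $r$ partition sets have sizes $\lfloor n/r\rfloor$ or $\lceil n/r\rceil$ (so $T_r(n)=K_n$ if $n\le r$). Let $S_{n,k}=K_k\vee\overline{K}_{n-k}$ be the graph of order $n$ obtained by joining every vertex of a complete graph of order $k$ to every vertex of an independent set of order $n-k$, with the convention $S_{n,k}=K_n$ if $k\ge n$. A graph is called complete $r$-partite if its vertex set can be partitioned into exactly $r$ nonempty sets such that two vertices are adjacent if and only if they lie in different sets. (i) If $0\le\alpha<1-1/r$, then $\lambda(A_\alpha(G))<\lambda(A_\alpha(T_r(n)))$, unless $G$ is isomorphic to $T_r(n)$. (ii) If $1-1/r<\alpha<1$, then $\lambda(A_\alpha(G))<\lambda(A_\alpha(S_{n,r-1}))$,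 unless $G$ is isomorphic to $S_{n,r-1}$. (iii) If $\alpha=1-1/r$, then $\lambda(A_\alpha(G))\le(1-1/r)\,n$, with equality if and only if $G$ is a complete $r$-partite graph. -/

import Mathlib

namespace AlphaTuran

/-- The matrix `A_α(G) = α D(G) + (1 - α) A(G)`. -/
def alphaMatrix {V : Type*} [Fintype V] [DecidableEq V] (α : ℝ) (G : SimpleGraph V)
    [DecidableRel G.Adj] : Matrix V V ℝ :=
  α • G.degMatrix ℝ + (1 - α) • G.adjMatrix ℝ

/-- The largest eigenvalue `λ(M)` of a real symmetric matrix `M` of positive order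
(there the supremum is attained, see `isGreatest_largestEigenvalue`). -/
noncomputable def largestEigenvalue {V : Type*} [Fintype V] [DecidableEq V]
    (M : Matrix V V ℝ) : ℝ :=
  sSup {μ : ℝ | Module.End.HasEigenvalue (Matrix.toLin' M) μ}

/-- The graph `S_{n,k} = K_k ∨ (complement of K_{n-k})` on `Fin n`: the first `k` vertices are
joined to every other vertex, and the remaining `n - k` vertices are independent.
For `k ≥ n` this is the complete graph `K_n`. -/
def splitGraph (n k : ℕ) : SimpleGraph (Fin n) where
  Adj u v := u ≠ v ∧ ((u : ℕ) < k ∨ (v : ℕ) < k)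
  symm := ⟨fun _ _ h => ⟨h.1.symm, h.2.symm⟩⟩
  loopless := ⟨fun _ h => h.1 rfl⟩

instance (n k : ℕ) : DecidableRel (splitGraph n k).Adj :=
  inferInstanceAs (DecidableRel fun u v : Fin n => u ≠ v ∧ ((u : ℕ) < k ∨ (v : ℕ) < k))

/-- `G` is complete `r`-partite: the vertices are partitioned into `r` nonempty classes
(the fibres of `f`), and two vertices are adjacent exactly when their classes differ. -/
def IsCompletePartite {V : Type*} (G : SimpleGraph V) (r : ℕ) : Prop :=
  ∃ f : V → Fin r, Function.Surjective f ∧ ∀ u v, G.Adj u v ↔ f u ≠ f v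

theorem alphaMatrix_isHermitian {V : Type*} [Fintype V] [DecidableEq V] (α : ℝ)
    (G : SimpleGraph V) [DecidableRel G.Adj] : (alphaMatrix α G).IsHermitian := by
  have h : (alphaMatrix α G).IsSymm := by
    unfold alphaMatrix SimpleGraph.degMatrix
    exact ((Matrix.isSymm_diagonal _).smul _).add ((G.isSymm_adjMatrix).smul _)
  rw [Matrix.IsHermitian, Matrix.conjTranspose_eq_transpose_of_trivial]
  exact h

theorem isGreatest_largestEigenvalue {V : Type*} [Fintype V] [DecidableEq V] [Nonempty V]
    {M : Matrix V V ℝ} (hM : M.IsHermitian) :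
    IsGreatest {μ : ℝ | Module.End.HasEigenvalue (Matrix.toLin' M) μ} (largestEigenvalue M) := by
  have h : {μ : ℝ | Module.End.HasEigenvalue (Matrix.toLin' M) μ} = Set.range hM.eigenvalues := by
    rw [← hM.spectrum_real_eq_range_eigenvalues, ← Matrix.spectrum_toLin']
    ext μ
    exact Module.End.hasEigenvalue_iff_mem_spectrum
  have hf : (Set.range hM.eigenvalues).Finite := Set.finite_range _
  unfold largestEigenvalue
  rw [h]
  exact ⟨(Set.range_nonempty _).csSup_mem hf, fun _ hx => le_csSup hf.bddAbove hx⟩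

end AlphaTuran

/-! Among the finitely many `K_{r+1}`-free graphs on `V`, take one of largest index λ, with a
nonnegative eigenvector `x`. Zykov symmetrization applies to it: overwriting a vertex by a twin of a
non-neighbour is a pullback along a map `V → V`, so no `K_{r+1}` appears, and `x` pulled back is a
test vector for the new graph. Comparing Rayleigh quotients gives `x > 0` (`eigenvector_pos`) and
transitivity of non-adjacency (`not_adj_trans`). Hence the graph is complete multipartite, with `r`
nonempty classes unless it is a complete graph on fewer than `r` vertices (`exists_eq_fibreGraph`).

Let the classes have sizes m_i, and write λ = αn + μ. The eigenvector equations give (1 - α) ∑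
m_i/(μ + m_i) = 1 (`secular_equation`). For any other choice of sizes with all μ + m_i positive, the
test vector 1/(μ + m) shows that the left side is at most 1 (`secular_le`). So the m_i maximize a
sum of values of m/(μ + m) = 1 - μ/(μ + m), which is concave in m for μ > 0, constant for μ = 0 and
convex for μ < 0; `move_le` expresses this for one moved vertex.

The secular equation forces μ to have the sign of 1 - 1/r - α. Concavity balances the classes and
gives the Turán graph; convexity leaves at most one class with more than one vertex and gives the
split graph; for μ = 0 all complete r-partite graphs tie. -/

open Finset Matrix

namespace AlphaTuran

/-! ### The quadratic form, edge by edge. -/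

section EdgeTerm

variable {V : Type*}

/-- The contribution of an oriented edge with end values `a` and `b` to the quadratic form. -/
noncomputable def edgeTerm (α a b : ℝ) : ℝ := α * (a ^ 2 + b ^ 2) / 2 + (1 - α) * (a * b)

theorem edgeTerm_comm (α a b : ℝ) : edgeTerm α a b = edgeTerm α b a := by
  unfold edgeTerm; ring

theorem edgeTerm_nonneg {α a b : ℝ} (h0 : 0 ≤ α) (h1 : α < 1) (ha : 0 ≤ a) (hb : 0 ≤ b) :
    0 ≤ edgeTerm α a b := by
  have : 0 ≤ 1 - α := by linarith
  unfold edgeTerm; positivity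

theorem edgeTerm_pos {α a b : ℝ} (h0 : 0 ≤ α) (h1 : α < 1) (ha : 0 < a) (hb : 0 < b) :
    0 < edgeTerm α a b := by
  have : 0 < 1 - α := by linarith
  unfold edgeTerm; positivity

open Classical in
/-- `edgeTerm` on adjacent pairs, and zero elsewhere. -/
noncomputable def pairTerm (α : ℝ) (G : SimpleGraph V) (x : V → ℝ) (u v : V) : ℝ :=
  if G.Adj u v then edgeTerm α (x u) (x v) else 0

theorem pairTerm_comm (α : ℝ) (G : SimpleGraph V) (x : V → ℝ) (u v : V) :
    pairTerm α G x u v = pairTerm α G x v u := by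
  unfold pairTerm
  rw [edgeTerm_comm α (x u)]
  congr 1
  exact propext (G.adj_comm u v)

theorem pairTerm_of_not_adj {G : SimpleGraph V} {α : ℝ} {x : V → ℝ}
    {u v : V} (h : ¬ G.Adj u v) : pairTerm α G x u v = 0 := if_neg h

theorem pairTerm_nonneg {α : ℝ} (h0 : 0 ≤ α) (h1 : α < 1) (G : SimpleGraph V) {x : V → ℝ}
    (hx : ∀ v, 0 ≤ x v) (u v : V) : 0 ≤ pairTerm α G x u v := by
  unfold pairTerm
  split_ifs
  exacts [edgeTerm_nonneg h0 h1 (hx _) (hx _), le_rfl]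

end EdgeTerm

theorem dotProduct_self_eq_sum_sq {V : Type*} [Fintype V] (x : V → ℝ) : x ⬝ᵥ x = ∑ v, x v ^ 2 := by
  simp [dotProduct, sq]

variable {V : Type*} [Fintype V] [DecidableEq V]

/-! ### Rayleigh quotients. -/

section Rayleigh

variable {M : Matrix V V ℝ}

theorem posSemidef_largestEigenvalue_sub [Nonempty V] (hM : M.IsHermitian) :
    (largestEigenvalue M • (1 : Matrix V V ℝ) - M).PosSemidef := by
  rw [Matrix.posSemidef_iff_isHermitian_and_spectrum_nonneg]
  have h1 : (largestEigenvalue M • (1 : Matrix V V ℝ)).IsHermitian := by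
    rw [Matrix.IsHermitian, Matrix.conjTranspose_smul, Matrix.conjTranspose_one, star_trivial]
  refine ⟨h1.sub hM, fun μ hμ => ?_⟩
  rw [← Algebra.algebraMap_eq_smul_one, ← spectrum.singleton_sub_eq] at hμ
  obtain ⟨_, rfl, ν, hν, rfl⟩ := hμ
  rw [← Matrix.spectrum_toLin', ← Module.End.hasEigenvalue_iff_mem_spectrum] at hν
  exact sub_nonneg.2 ((isGreatest_largestEigenvalue hM).2 hν)

theorem dotProduct_largestEigenvalue_sub (x : V → ℝ) :
    star x ⬝ᵥ (largestEigenvalue M • (1 : Matrix V V ℝ) - M) *ᵥ x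
      = largestEigenvalue M * (x ⬝ᵥ x) - x ⬝ᵥ M *ᵥ x := by
  rw [Matrix.sub_mulVec, dotProduct_sub, Matrix.smul_mulVec, Matrix.one_mulVec, dotProduct_smul]
  rfl

theorem dotProduct_mulVec_le_largestEigenvalue [Nonempty V] (hM : M.IsHermitian) (x : V → ℝ) :
    x ⬝ᵥ M *ᵥ x ≤ largestEigenvalue M * (x ⬝ᵥ x) := by
  have h := (posSemidef_largestEigenvalue_sub hM).dotProduct_mulVec_nonneg x
  rw [dotProduct_largestEigenvalue_sub] at h
  linarith

/-- A positive semidefinite form vanishes only on the kernel of its matrix, here λI - M. -/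
theorem mulVec_eq_of_dotProduct_eq [Nonempty V] (hM : M.IsHermitian) {x : V → ℝ}
    (hx : x ⬝ᵥ M *ᵥ x = largestEigenvalue M * (x ⬝ᵥ x)) : M *ᵥ x = largestEigenvalue M • x := by
  have h := ((posSemidef_largestEigenvalue_sub hM).dotProduct_mulVec_zero_iff x).1 (by
    rw [dotProduct_largestEigenvalue_sub, hx, sub_self])
  rw [Matrix.sub_mulVec, Matrix.smul_mulVec, Matrix.one_mulVec, sub_eq_zero] at h
  exact h.symm

end Rayleigh

/-- The quadratic form of `A_α(G)`. -/
noncomputable def quadForm (α : ℝ) (G : SimpleGraph V) (x : V → ℝ) : ℝ :=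
  ∑ u, ∑ v, pairTerm α G x u v

open Classical in
/-- The largest eigenvalue of `A_α(G)`. -/
noncomputable def alphaIndex (α : ℝ) (G : SimpleGraph V) : ℝ :=
  largestEigenvalue (alphaMatrix α G)

theorem largestEigenvalue_alphaMatrix (α : ℝ) (G : SimpleGraph V) [DecidableRel G.Adj] :
    largestEigenvalue (alphaMatrix α G) = alphaIndex α G := by
  unfold alphaIndex
  congr!

open Classical in
theorem alphaMatrix_mulVec (α : ℝ) (G : SimpleGraph V) (x : V → ℝ) (v : V) :
    (alphaMatrix α G *ᵥ x) v = ∑ w, if G.Adj v w then α * x v + (1 - α) * x w else 0 := by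
  simp only [alphaMatrix, Matrix.add_mulVec, Matrix.smul_mulVec, SimpleGraph.degMatrix,
    Pi.add_apply, Pi.smul_apply, Matrix.mulVec_diagonal, SimpleGraph.adjMatrix_mulVec_apply,
    smul_eq_mul]
  rw [← SimpleGraph.card_neighborFinset_eq_degree, SimpleGraph.neighborFinset_eq_filter,
    ← Finset.sum_filter, Finset.sum_add_distrib, Finset.sum_const, nsmul_eq_mul, Finset.mul_sum]
  ring

open Classical in
theorem dotProduct_alphaMatrix_mulVec (α : ℝ) (G : SimpleGraph V) (x : V → ℝ) :
    x ⬝ᵥ alphaMatrix α G *ᵥ x = quadForm α G x := by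
  have key : ∑ u, ∑ v, (if G.Adj u v then α * x u ^ 2 / 2 else 0)
      = ∑ u, ∑ v, (if G.Adj u v then α * x v ^ 2 / 2 else 0) := by
    rw [Finset.sum_comm]
    simp [G.adj_comm]
  have e1 : x ⬝ᵥ alphaMatrix α G *ᵥ x = ∑ u, ∑ v, (if G.Adj u v then α * x u ^ 2 / 2 else 0)
      + ∑ u, ∑ v, ((if G.Adj u v then α * x u ^ 2 / 2 else 0)
        + (if G.Adj u v then (1 - α) * (x u * x v) else 0)) := by
    rw [← Finset.sum_add_distrib]
    refine Finset.sum_congr rfl fun u _ => ?_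
    rw [alphaMatrix_mulVec, Finset.mul_sum, ← Finset.sum_add_distrib]
    refine Finset.sum_congr rfl fun v _ => ?_
    split_ifs <;> ring
  rw [e1, key, ← Finset.sum_add_distrib]
  refine Finset.sum_congr rfl fun u _ => ?_
  rw [← Finset.sum_add_distrib]
  refine Finset.sum_congr rfl fun v _ => ?_
  unfold pairTerm edgeTerm
  split_ifs <;> ring

theorem quadForm_le [Nonempty V] (α : ℝ) (G : SimpleGraph V) (x : V → ℝ) :
    quadForm α G x ≤ alphaIndex α G * ∑ v, x v ^ 2 := by
  classical
  have h := dotProduct_mulVec_le_largestEigenvalue (alphaMatrix_isHermitian α G) x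
  rwa [dotProduct_alphaMatrix_mulVec, dotProduct_self_eq_sum_sq] at h

open Classical in
theorem eigen_equation [Nonempty V] {α : ℝ} {G : SimpleGraph V} {x : V → ℝ}
    (hx : quadForm α G x = alphaIndex α G * ∑ v, x v ^ 2) (v : V) :
    ∑ w, (if G.Adj v w then α * x v + (1 - α) * x w else 0) = alphaIndex α G * x v := by
  rw [← dotProduct_alphaMatrix_mulVec, ← dotProduct_self_eq_sum_sq] at hx
  have h := congrFun (mulVec_eq_of_dotProduct_eq (alphaMatrix_isHermitian α G) hx) v
  rwa [alphaMatrix_mulVec] at h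

/-- Passing from an eigenvector to its absolute values keeps the norm and, since 1 - α ≥ 0, does not
decrease the form. -/
theorem exists_nonneg_eigenvector [Nonempty V] {α : ℝ} (h1 : α ≤ 1) (G : SimpleGraph V) :
    ∃ x : V → ℝ, (∀ v, 0 ≤ x v) ∧ (∃ v, 0 < x v) ∧
      quadForm α G x = alphaIndex α G * ∑ v, x v ^ 2 := by
  classical
  obtain ⟨y, hy⟩ :=
    (isGreatest_largestEigenvalue (alphaMatrix_isHermitian α G)).1.exists_hasEigenvector
  have hy1 : alphaMatrix α G *ᵥ y = alphaIndex α G • y := by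
    rw [← Matrix.toLin'_apply, hy.apply_eq_smul, largestEigenvalue_alphaMatrix]
  have hq : quadForm α G y = alphaIndex α G * ∑ v, y v ^ 2 := by
    rw [← dotProduct_alphaMatrix_mulVec, hy1, dotProduct_smul, dotProduct_self_eq_sum_sq]
    rfl
  refine ⟨fun v => |y v|, fun v => abs_nonneg _, ?_, ?_⟩
  · obtain ⟨v, hv⟩ := Function.ne_iff.1 hy.2
    exact ⟨v, abs_pos.2 hv⟩
  · refine le_antisymm (quadForm_le _ _ _) ?_
    simp only [sq_abs]
    rw [← hq]
    refine Finset.sum_le_sum fun u _ => Finset.sum_le_sum fun v _ => ?_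
    unfold pairTerm edgeTerm
    split_ifs
    · simp only [sq_abs]
      have : y u * y v ≤ |y u| * |y v| := by rw [← abs_mul]; exact le_abs_self _
      have := mul_le_mul_of_nonneg_left this (sub_nonneg.2 h1)
      linarith
    · exact le_rfl

theorem alphaIndex_le_of_iso {W : Type*} [Fintype W] [DecidableEq W] [Nonempty V] [Nonempty W]
    {α : ℝ} (h1 : α ≤ 1) {G : SimpleGraph V} {H : SimpleGraph W} (e : G ≃g H) :
    alphaIndex α G ≤ alphaIndex α H := by
  obtain ⟨x, -, ⟨v, hv⟩, hx⟩ := exists_nonneg_eigenvector h1 G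
  have h := quadForm_le α H (x ∘ e.symm)
  have e1 : quadForm α H (x ∘ e.symm) = quadForm α G x := by
    unfold quadForm
    rw [← e.toEquiv.sum_comp]
    refine Finset.sum_congr rfl fun a _ => ?_
    rw [← e.toEquiv.sum_comp]
    refine Finset.sum_congr rfl fun b _ => ?_
    simp only [pairTerm, Function.comp_apply, RelIso.coe_fn_toEquiv, RelIso.symm_apply_apply]
    congr 1
    exact propext e.map_adj_iff
  have e2 : ∑ w, (x ∘ e.symm) w ^ 2 = ∑ v, x v ^ 2 := by
    rw [← e.toEquiv.sum_comp]
    simp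
  rw [e1, e2, hx] at h
  refine le_of_mul_le_mul_right h ?_
  exact Finset.sum_pos' (fun _ _ => sq_nonneg _) ⟨v, Finset.mem_univ _, by positivity⟩

theorem alphaIndex_eq_of_iso {W : Type*} [Fintype W] [DecidableEq W] [Nonempty V] [Nonempty W]
    {α : ℝ} (h1 : α ≤ 1) {G : SimpleGraph V} {H : SimpleGraph W} (e : G ≃g H) :
    alphaIndex α G = alphaIndex α H :=
  le_antisymm (alphaIndex_le_of_iso h1 e) (alphaIndex_le_of_iso h1 e.symm)

end AlphaTuran

/-! ### Zykov symmetrization of an index-maximal graph. -/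

namespace AlphaTuran

/-- A clique of the pullback maps homomorphically to `G`, and homomorphisms from a complete graph
are injective because `G` has no loops. So σ need not be injective, which is what allows twins. -/
theorem cliqueFree_comap {V W : Type*} {G : SimpleGraph W} {n : ℕ} (h : G.CliqueFree n)
    (σ : V → W) : (G.comap σ).CliqueFree n := by
  contrapose h
  rw [SimpleGraph.not_cliqueFree_iff_top_isContained] at h ⊢
  obtain ⟨c⟩ := h
  let g : (⊤ : SimpleGraph (Fin n)) →g G := ⟨fun i => σ (c i), fun hab => c.toHom.map_adj hab⟩
  exact ⟨⟨g, SimpleGraph.Hom.injective_of_top_hom g⟩⟩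

/-- The complete multipartite graph whose classes are the fibres of `f`. -/
def fibreGraph {V ι : Type*} (f : V → ι) : SimpleGraph V := (⊤ : SimpleGraph ι).comap f

theorem fibreGraph_adj {V ι : Type*} {f : V → ι} {u v : V} :
    (fibreGraph f).Adj u v ↔ f u ≠ f v := Iff.rfl

theorem fibreGraph_cliqueFree {V : Type*} {r : ℕ} (f : V → Fin r) :
    (fibreGraph f).CliqueFree (r + 1) :=
  cliqueFree_comap (SimpleGraph.cliqueFree_of_card_lt (by simp)) f

theorem sum_comp_update {V W : Type*} [Fintype V] [DecidableEq V] (F : W → ℝ) (τ : V → W) (u : V)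
    (w : W) : ∑ a, F (Function.update τ u w a) = ∑ a, F (τ a) + F w - F (τ u) := by
  have h : ∀ a, F (Function.update τ u w a) = F (τ a) + if a = u then F w - F (τ u) else 0 := by
    intro a
    by_cases hau : a = u
    · subst hau; simp
    · simp [hau]
  simp only [h, Finset.sum_add_distrib, Finset.sum_ite_eq', Finset.mem_univ, if_true]
  ring

/-- Bookkeeping for overwriting one vertex, with an arbitrary kernel and map so that it can be
iterated for two overwritten vertices. -/
theorem sum_sum_comp_update {V W : Type*} [Fintype V] [DecidableEq V] (T : W → W → ℝ) (τ : V → W)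
    (u : V) (w : W) :
    ∑ a, ∑ b, T (Function.update τ u w a) (Function.update τ u w b)
      = ∑ a, ∑ b, T (τ a) (τ b) + ∑ a, T (τ a) w - ∑ a, T (τ a) (τ u)
        + (∑ b, T w (τ b) + T w w - T w (τ u))
        - (∑ b, T (τ u) (τ b) + T (τ u) w - T (τ u) (τ u)) := by
  have h := sum_comp_update (fun c => ∑ b, T c (τ b) + T c w - T c (τ u)) τ u w
  rw [Finset.sum_congr rfl fun a _ => sum_comp_update (T (Function.update τ u w a)) τ u w]
  simp only [Finset.sum_add_distrib, Finset.sum_sub_distrib] at h ⊢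
  exact h

variable {V : Type*} [Fintype V] [DecidableEq V]

/-- The part of `quadForm α G x - λ ∑ x²` that involves the vertex `c`. -/
noncomputable def vertexTerm (α : ℝ) (G : SimpleGraph V) (x : V → ℝ) (c : V) :
    ℝ :=
  2 * ∑ d, pairTerm α G x c d - alphaIndex α G * x c ^ 2

/-- `G` has the largest `A_α`-index among the `K_{r+1}`-free graphs on its vertex set. -/
def IsIndexMaximal (α : ℝ) (r : ℕ) (G : SimpleGraph V) : Prop :=
  G.CliqueFree (r + 1) ∧
    ∀ H : SimpleGraph V, H.CliqueFree (r + 1) → alphaIndex α H ≤ alphaIndex α G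

theorem exists_isIndexMaximal (α : ℝ) (r : ℕ) :
    ∃ G : SimpleGraph V, IsIndexMaximal α (r + 1) G := by
  have : Nonempty {H : SimpleGraph V // H.CliqueFree (r + 1 + 1)} :=
    ⟨⟨⊥, SimpleGraph.cliqueFree_bot (by omega)⟩⟩
  obtain ⟨⟨G, hG⟩, h⟩ := Finite.exists_max
    fun H : {H : SimpleGraph V // H.CliqueFree (r + 1 + 1)} => alphaIndex α H.1
  exact ⟨G, hG, fun H hH => h ⟨H, hH⟩⟩

namespace IsIndexMaximal

variable [Nonempty V] {α : ℝ} {r : ℕ} {G : SimpleGraph V} {x : V → ℝ}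

theorem quadForm_le (hG : IsIndexMaximal α r G) {H : SimpleGraph V} (hH : H.CliqueFree (r + 1))
    (y : V → ℝ) : quadForm α H y ≤ alphaIndex α G * ∑ v, y v ^ 2 :=
  (AlphaTuran.quadForm_le α H y).trans
    (mul_le_mul_of_nonneg_right (hG.2 H hH) (Finset.sum_nonneg fun _ _ => sq_nonneg _))

theorem sum_pairTerm_comp_le (hG : IsIndexMaximal α r G) (x : V → ℝ) (σ : V → V) :
    ∑ a, ∑ b, pairTerm α G x (σ a) (σ b) ≤ alphaIndex α G * ∑ a, x (σ a) ^ 2 :=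
  hG.quadForm_le (cliqueFree_comap hG.1 σ) (x ∘ σ)

theorem vertexTerm_le (hG : IsIndexMaximal α r G)
    (hx : quadForm α G x = alphaIndex α G * ∑ v, x v ^ 2) {u v : V} (huv : ¬ G.Adj u v) :
    vertexTerm α G x v ≤ vertexTerm α G x u := by
  -- Replace `u` by a twin of `v`, of weight `x v`. As `u` and `v` are not adjacent, the change is
  -- exactly the difference of their vertex terms.
  have h := hG.sum_pairTerm_comp_le x (Function.update id u v)
  rw [sum_sum_comp_update (pairTerm α G x), sum_comp_update (fun c => x c ^ 2)] at h
  simp only [id, pairTerm_of_not_adj (G.loopless.irrefl _), pairTerm_of_not_adj huv,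
    pairTerm_of_not_adj fun h' => huv h'.symm] at h
  have e1 := Finset.sum_congr (rfl : (univ : Finset V) = univ) fun c _ => pairTerm_comm α G x c v
  have e2 := Finset.sum_congr (rfl : (univ : Finset V) = univ) fun c _ => pairTerm_comm α G x c u
  rw [e1, e2] at h
  unfold quadForm at hx
  unfold vertexTerm
  linarith

theorem not_adj_trans (hG : IsIndexMaximal α r G) (h0 : 0 ≤ α) (h1 : α < 1)
    (hx : quadForm α G x = alphaIndex α G * ∑ v, x v ^ 2) (hpos : ∀ v, 0 < x v) {u v w : V}
    (huv : ¬ G.Adj u v) (hvw : ¬ G.Adj v w) : ¬ G.Adj u w := by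
  intro huw
  -- Replace both `u` and `w` by twins of `v`. Their vertex terms are at most that of `v`, and the
  -- edge `uw`, counted in both, is lost only once: a net gain of twice its pair term.
  have h := hG.sum_pairTerm_comp_le x (Function.update (Function.update id u v) w v)
  have hvu : ¬ G.Adj v u := fun h' => huv h'.symm
  have hwv : ¬ G.Adj w v := fun h' => hvw h'.symm
  rw [sum_sum_comp_update (pairTerm α G x), sum_sum_comp_update (pairTerm α G x),
    sum_comp_update (fun c => pairTerm α G x c v),
    sum_comp_update (fun c => pairTerm α G x c (Function.update id u v w)),
    sum_comp_update (pairTerm α G x v),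
    sum_comp_update (pairTerm α G x (Function.update id u v w)),
    sum_comp_update (fun c => x c ^ 2), sum_comp_update (fun c => x c ^ 2)] at h
  simp only [id, Function.update_of_ne huw.ne', pairTerm_of_not_adj (G.loopless.irrefl _),
    pairTerm_of_not_adj huv, pairTerm_of_not_adj hvw, pairTerm_of_not_adj hvu,
    pairTerm_of_not_adj hwv] at h
  have e1 := Finset.sum_congr (rfl : (univ : Finset V) = univ) fun c _ => pairTerm_comm α G x c v
  have e2 := Finset.sum_congr (rfl : (univ : Finset V) = univ) fun c _ => pairTerm_comm α G x c u
  have e3 := Finset.sum_congr (rfl : (univ : Finset V) = univ) fun c _ => pairTerm_comm α G x c w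
  rw [e1, e2, e3, pairTerm_comm α G x w u] at h
  have hu := hG.vertexTerm_le hx hvu
  have hw := hG.vertexTerm_le hx hvw
  have hp : 0 < pairTerm α G x u w := by
    rw [pairTerm, if_pos huw]
    exact edgeTerm_pos h0 h1 (hpos u) (hpos w)
  unfold vertexTerm at hu hw
  unfold quadForm at hx
  linarith

theorem alphaIndex_pos [Nontrivial V] (hG : IsIndexMaximal α r G) (hr : 2 ≤ r) (h0 : 0 ≤ α)
    (h1 : α < 1) : 0 < alphaIndex α G := by
  obtain ⟨u, v, huv⟩ := exists_pair_ne V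
  let f : V → Fin r := fun a => if a = u then ⟨0, by omega⟩ else ⟨1, by omega⟩
  have h := hG.quadForm_le (fibreGraph_cliqueFree f) fun _ => 1
  have hnn := pairTerm_nonneg h0 h1 (fibreGraph f) (x := fun _ => 1) fun _ => zero_le_one
  have hpos : 0 < quadForm α (fibreGraph f) fun _ => 1 := by
    refine Finset.sum_pos' (fun a _ => Finset.sum_nonneg fun b _ => hnn a b)
      ⟨u, Finset.mem_univ _, Finset.sum_pos' (fun b _ => hnn u b) ⟨v, Finset.mem_univ _, ?_⟩⟩
    rw [pairTerm, if_pos]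
    · exact edgeTerm_pos h0 h1 one_pos one_pos
    · rw [fibreGraph_adj]; simp [f, huv.symm]
  refine pos_of_mul_pos_left (hpos.trans_le h) (Finset.sum_nonneg fun _ _ => sq_nonneg _)

/-- Maximality stands in for connectedness in the Perron–Frobenius argument. Zeros of `x` spread to
neighbours, so a zero `z` has vertex term 0; comparison with a non-neighbour `v` where `x v > 0`
forces `v` to be isolated, contrary to λ > 0. -/
theorem eigenvector_pos [Nontrivial V] (hG : IsIndexMaximal α r G) (hr : 2 ≤ r) (h0 : 0 ≤ α)
    (h1 : α < 1) (hx : quadForm α G x = alphaIndex α G * ∑ v, x v ^ 2) (hnn : ∀ v, 0 ≤ x v)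
    (hne : ∃ v, 0 < x v) (z : V) : 0 < x z := by
  classical
  have h1' : 0 < 1 - α := by linarith
  have hnbr : ∀ {a b}, x a = 0 → G.Adj a b → x b = 0 := by
    intro a b ha hab
    have h := eigen_equation hx a
    simp only [ha, mul_zero] at h
    rw [Finset.sum_eq_zero_iff_of_nonneg] at h
    · have hb := h b (Finset.mem_univ _)
      rw [if_pos hab] at hb
      have : (1 - α) * x b = 0 := by linarith
      exact (mul_eq_zero.1 this).resolve_left h1'.ne'
    · intro b _
      split_ifs
      · have := mul_nonneg h1'.le (hnn b)
        linarith
      · exact le_rfl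
  refine (hnn z).lt_of_ne fun hz => ?_
  replace hz := hz.symm
  obtain ⟨v, hv⟩ := hne
  have hzv : ¬ G.Adj z v := fun h => hv.ne' (hnbr hz h)
  have hle := hG.vertexTerm_le hx hzv
  have hz0 : vertexTerm α G x z = 0 := by
    unfold vertexTerm
    rw [hz, Finset.sum_eq_zero]
    · ring
    · intro d _
      unfold pairTerm
      split_ifs with hd
      · rw [hz, hnbr hz hd]; unfold edgeTerm; ring
      · rfl
  -- The eigenvector equation at `v` eliminates λ and leaves a sum of nonnegative terms.
  have hv' : vertexTerm α G x v
      = ∑ d, if G.Adj v d then α * x d ^ 2 + (1 - α) * (x v * x d) else 0 := by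
    unfold vertexTerm
    rw [sq, ← mul_assoc, ← eigen_equation hx v, Finset.mul_sum, Finset.sum_mul,
      ← Finset.sum_sub_distrib]
    refine Finset.sum_congr rfl fun d _ => ?_
    unfold pairTerm edgeTerm
    split_ifs <;> ring
  have hterm : ∀ d, 0 ≤ if G.Adj v d then α * x d ^ 2 + (1 - α) * (x v * x d) else 0 := by
    intro d
    have := hnn d
    split_ifs <;> positivity
  rw [hz0, hv'] at hle
  have hall := (Finset.sum_eq_zero_iff_of_nonneg fun d _ => hterm d).1
    (hle.antisymm (Finset.sum_nonneg fun d _ => hterm d))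
  have hiso : ∀ d, ¬ G.Adj v d := by
    intro d hd
    have hxd : 0 < x d := (hnn d).lt_of_ne fun h => hv.ne' (hnbr h.symm hd.symm)
    have := hall d (Finset.mem_univ _)
    rw [if_pos hd] at this
    have : 0 < (1 - α) * (x v * x d) := by positivity
    have : 0 ≤ α * x d ^ 2 := by positivity
    linarith
  have heq := eigen_equation hx v
  simp only [hiso, if_false, Finset.sum_const_zero] at heq
  exact (mul_pos (hG.alphaIndex_pos hr h0 h1) hv).ne heq

theorem eq_of_le (hG : IsIndexMaximal α r G) (h0 : 0 ≤ α) (h1 : α < 1)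
    (hx : quadForm α G x = alphaIndex α G * ∑ v, x v ^ 2) (hpos : ∀ v, 0 < x v)
    {H : SimpleGraph V} (hH : H.CliqueFree (r + 1)) (hGH : G ≤ H) : G = H := by
  refine le_antisymm hGH fun u v huv => ?_
  by_contra hn
  have h := hG.quadForm_le hH x
  rw [← hx] at h
  have hle : ∀ a b, pairTerm α G x a b ≤ pairTerm α H x a b := by
    intro a b
    by_cases hab : G.Adj a b
    · rw [pairTerm, pairTerm, if_pos hab, if_pos (hGH hab)]
    · rw [pairTerm_of_not_adj hab]
      exact pairTerm_nonneg h0 h1 H (fun v => (hpos v).le) a b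
  refine h.not_gt (Finset.sum_lt_sum (fun a _ => Finset.sum_le_sum fun b _ => hle a b)
    ⟨u, Finset.mem_univ _, Finset.sum_lt_sum (fun b _ => hle u b) ⟨v, Finset.mem_univ _, ?_⟩⟩)
  rw [pairTerm_of_not_adj hn, pairTerm, if_pos huv]
  exact edgeTerm_pos h0 h1 (hpos u) (hpos v)

/-- An index-maximal graph is complete multipartite; either all its `r` classes are nonempty,
or it is a complete graph on fewer than `r` vertices. -/
theorem exists_eq_fibreGraph (hG : IsIndexMaximal α r G) (hr : 2 ≤ r) (h0 : 0 ≤ α)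
    (h1 : α < 1) : ∃ f : V → Fin r, G = fibreGraph f ∧
      (Function.Surjective f ∨ (Function.Injective f ∧ Fintype.card V < r)) := by
  have hcard : ∀ f : V → Fin r, Function.Injective f → G = fibreGraph f →
      ∃ f : V → Fin r, G = fibreGraph f ∧
      (Function.Surjective f ∨ (Function.Injective f ∧ Fintype.card V < r)) := by
    intro f hf hGf
    refine ⟨f, hGf, or_iff_not_imp_left.2 fun hs => ⟨hf, ?_⟩⟩
    have := Fintype.card_lt_of_injective_not_surjective f hf hs
    simpa using this
  -- A single vertex has index 0, so positivity of λ needs two vertices.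
  rcases subsingleton_or_nontrivial V with hV | hV
  · refine hcard (fun _ => ⟨0, by omega⟩) (Function.injective_of_subsingleton _) ?_
    exact Subsingleton.elim _ _
  obtain ⟨x, hnn, hne, hx⟩ := exists_nonneg_eigenvector h1.le G
  have hpos := hG.eigenvector_pos hr h0 h1 hx hnn hne
  have hcm : G.IsCompleteMultipartite := ⟨fun _ _ _ => hG.not_adj_trans h0 h1 hx hpos⟩
  obtain ⟨c⟩ := hcm.colorable_of_cliqueFree hG.1
  let f : V → Fin r := c
  have hf : G = fibreGraph f :=
    hG.eq_of_le h0 h1 hx hpos (fibreGraph_cliqueFree f) fun u v huv => c.valid huv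
  by_cases hinj : Function.Injective f
  · exact hcard f hinj hf
  refine ⟨f, hf, Or.inl fun i => ?_⟩
  by_contra! hi
  simp only [Function.Injective, not_forall] at hinj
  obtain ⟨u, v, huv, hne'⟩ := hinj
  -- Moving `u` alone into the empty class `i` keeps every edge and adds `uv`, against
  -- edge-maximality.
  have hG' := hG.eq_of_le h0 h1 hx hpos (fibreGraph_cliqueFree (Function.update f u i)) (by
    rw [hf]
    intro a b hab
    rw [fibreGraph_adj] at hab ⊢
    by_cases ha : a = u <;> by_cases hb : b = u
    · exact absurd (ha.trans hb.symm ▸ rfl) hab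
    · subst ha; simpa [hb] using (hi b).symm
    · subst hb; simpa [ha] using hi a
    · simpa [ha, hb] using hab)
  have hadj : (fibreGraph (Function.update f u i)).Adj u v := by
    rw [fibreGraph_adj]; simpa [Ne.symm hne'] using (hi v).symm
  rw [← hG', hf] at hadj
  exact hadj huv

end IsIndexMaximal

end AlphaTuran

/-! ### Class sizes and the secular equation. -/

namespace AlphaTuran

/-- The number of elements of the fibre of `f` over `i`, as a real number. -/
noncomputable def fibreCard {V ι : Type*} [Fintype V] [DecidableEq ι] (f : V → ι) (i : ι) : ℝ :=
  ∑ v, if f v = i then 1 else 0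

theorem fibreCard_eq {V ι : Type*} [Fintype V] [DecidableEq ι] (f : V → ι) (i : ι) :
    fibreCard f i = (#{v | f v = i} : ℕ) := by
  simp [fibreCard]

theorem one_le_fibreCard {V ι : Type*} [Fintype V] [DecidableEq ι] {f : V → ι}
    (hf : Function.Surjective f) (i : ι) : 1 ≤ fibreCard f i := by
  obtain ⟨v, rfl⟩ := hf i
  rw [fibreCard_eq, Nat.one_le_cast, Nat.one_le_iff_ne_zero]
  exact Finset.card_ne_zero_of_mem (a := v) (by simp)

theorem fibreCard_update {V ι : Type*} [Fintype V] [DecidableEq V] [DecidableEq ι] (f : V → ι)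
    (u : V) (j k : ι) : fibreCard (Function.update f u j) k
      = fibreCard f k + (if j = k then 1 else 0) - if f u = k then 1 else 0 :=
  sum_comp_update (fun c => if c = k then (1 : ℝ) else 0) f u j

theorem sum_comp_eq_sum_fibreCard {V ι : Type*} [Fintype V] [Fintype ι] [DecidableEq ι]
    (f : V → ι) (z : ι → ℝ) : ∑ v, z (f v) = ∑ i, fibreCard f i * z i := by
  simp only [fibreCard, Finset.sum_mul]
  rw [Finset.sum_comm]
  simp

variable {V : Type*} [Fintype V] [DecidableEq V]

/-- If `y` is the reciprocal of `κ` plus the class size, then `A_α y - (α n + κ) y` is constant. -/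
theorem quadForm_fibreGraph {ι : Type*} [Fintype ι] [DecidableEq ι] (α κ : ℝ) (f : V → ι)
    (hκ : ∀ v, 0 < κ + fibreCard f (f v)) :
    quadForm α (fibreGraph f) (fun v => 1 / (κ + fibreCard f (f v)))
      = (α * Fintype.card V + κ) * ∑ v, (1 / (κ + fibreCard f (f v))) ^ 2
        + (∑ v, 1 / (κ + fibreCard f (f v)))
          * ((1 - α) * (∑ v, 1 / (κ + fibreCard f (f v))) - 1) := by
  classical
  set y : V → ℝ := fun v => 1 / (κ + fibreCard f (f v)) with hy
  rw [← dotProduct_alphaMatrix_mulVec, Finset.mul_sum, Finset.sum_mul, ← Finset.sum_add_distrib]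
  refine Finset.sum_congr rfl fun v _ => ?_
  have hrow : (alphaMatrix α (fibreGraph f) *ᵥ y) v
      = α * Fintype.card V * y v + (1 - α) * ∑ w, y w - fibreCard f (f v) * y v := by
    rw [alphaMatrix_mulVec]
    have h : ∀ w, (if (fibreGraph f).Adj v w then α * y v + (1 - α) * y w else 0)
        = α * y v + (1 - α) * y w - (if f w = f v then 1 else 0) * y v := by
      intro w
      by_cases hw : f w = f v
      · have : y w = y v := by simp only [hy, hw]
        rw [if_neg (fun h => h hw.symm), if_pos hw, this]; ring
      · rw [if_pos (fibreGraph_adj.2 fun h => hw h.symm), if_neg hw]; ring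
    simp only [h, Finset.sum_sub_distrib, Finset.sum_add_distrib, ← Finset.sum_mul,
      ← Finset.mul_sum, Finset.sum_const, Finset.card_univ, nsmul_eq_mul]
    unfold fibreCard
    ring
  rw [hrow]
  have hyv : (κ + fibreCard f (f v)) * y v = 1 := mul_one_div_cancel (hκ v).ne'
  have : fibreCard f (f v) * y v = 1 - κ * y v := by linarith
  rw [this]
  simp only [hy]
  ring

/-- The class sums of an eigenvector of a complete multipartite graph. -/
theorem sum_class_eigenvector [Nonempty V] {ι : Type*} [DecidableEq ι] {α : ℝ} {f : V → ι}
    {x : V → ℝ} (hx : quadForm α (fibreGraph f) x = alphaIndex α (fibreGraph f) * ∑ v, x v ^ 2)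
    (i : ι) :
    (alphaIndex α (fibreGraph f) - α * Fintype.card V + fibreCard f i)
        * (∑ v, if f v = i then x v else 0)
      = (1 - α) * (∑ v, x v) * fibreCard f i := by
  classical
  have hrow : ∀ v, f v = i → alphaIndex α (fibreGraph f) * x v
      = α * (Fintype.card V - fibreCard f i) * x v
        + (1 - α) * ((∑ w, x w) - ∑ w, if f w = i then x w else 0) := by
    intro v hv
    rw [← eigen_equation hx v]
    have h : ∀ w, (if (fibreGraph f).Adj v w then α * x v + (1 - α) * x w else 0)
        = α * x v + (1 - α) * x w - (if f w = i then 1 else 0) * (α * x v)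
          - (1 - α) * (if f w = i then x w else 0) := by
      intro w
      by_cases hw : f w = i
      · rw [if_neg (fun h => h (hv.trans hw.symm)), if_pos hw, if_pos hw]; ring
      · rw [if_pos (fibreGraph_adj.2 fun h => hw (h.symm.trans hv)), if_neg hw, if_neg hw]; ring
    simp only [h, Finset.sum_sub_distrib, Finset.sum_add_distrib, ← Finset.sum_mul,
      ← Finset.mul_sum, Finset.sum_const, Finset.card_univ, nsmul_eq_mul]
    unfold fibreCard
    ring
  set X := ∑ v, if f v = i then x v else 0 with hX
  have hsum : alphaIndex α (fibreGraph f) * X = α * (Fintype.card V - fibreCard f i) * X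
      + (1 - α) * ((∑ w, x w) - X) * fibreCard f i := by
    conv_lhs => rw [hX]
    conv_rhs => enter [1]; rw [hX]
    unfold fibreCard
    rw [Finset.mul_sum, Finset.mul_sum, Finset.mul_sum, ← Finset.sum_add_distrib]
    refine Finset.sum_congr rfl fun v _ => ?_
    split_ifs with hv
    · rw [hrow v hv, mul_one]; rfl
    · simp
  linarith

namespace IsIndexMaximal

variable [Nonempty V] {α : ℝ} {r : ℕ} {f : V → Fin r}

/-- The bound is the diagonal entry of `A_α` at the centre of a spanning star. It later gives μ >
-1. -/
theorem card_mul_le [Nontrivial V] {G : SimpleGraph V} (hG : IsIndexMaximal α r G) (hr : 2 ≤ r) :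
    α * (Fintype.card V - 1) ≤ alphaIndex α G := by
  classical
  obtain ⟨u⟩ := ‹Nonempty V›
  let g : V → Fin r := fun a => if a = u then ⟨0, by omega⟩ else ⟨1, by omega⟩
  have h := hG.quadForm_le (fibreGraph_cliqueFree g) (Pi.single u 1)
  have hadj : ∀ w, (fibreGraph g).Adj u w ↔ w ≠ u := by
    intro w
    rw [fibreGraph_adj]
    by_cases hw : w = u <;> simp [g, hw]
  rw [← dotProduct_alphaMatrix_mulVec, single_one_dotProduct, alphaMatrix_mulVec] at h
  have e1 : ∀ w, (if (fibreGraph g).Adj u w then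
      α * (Pi.single u 1 : V → ℝ) u + (1 - α) * (Pi.single u 1 : V → ℝ) w else 0)
      = α - if w = u then α else 0 := by
    intro w
    by_cases hw : w = u <;> simp [hadj, hw]
  have e2 : ∑ v, (Pi.single u 1 : V → ℝ) v ^ 2 = 1 := by
    rw [Finset.sum_eq_single u] <;> simp +contextual
  simp only [e1, e2, Finset.sum_sub_distrib, Finset.sum_const, Finset.card_univ, nsmul_eq_mul,
    Finset.sum_ite_eq', Finset.mem_univ, if_true] at h
  linarith

theorem alphaIndex_of_injective (hf : Function.Injective f) (h1 : α < 1) :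
    alphaIndex α (fibreGraph f) = Fintype.card V - 1 := by
  obtain ⟨x, hnn, ⟨v, hv⟩, hx⟩ := exists_nonneg_eigenvector h1.le (fibreGraph f)
  have hS : 0 < ∑ v, x v := Finset.sum_pos' (fun v _ => hnn v) ⟨v, Finset.mem_univ _, hv⟩
  have hrow : ∀ u, (alphaIndex α (fibreGraph f) - α * Fintype.card V + 1) * x u
      = (1 - α) * ∑ v, x v := by
    intro u
    have h := sum_class_eigenvector hx (f u)
    simpa [fibreCard, hf.eq_iff] using h
  have h : ∑ u, (alphaIndex α (fibreGraph f) - α * Fintype.card V + 1) * x u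
      = ∑ _u : V, (1 - α) * ∑ v, x v := Finset.sum_congr rfl fun u _ => hrow u
  rw [← Finset.mul_sum, Finset.sum_const, Finset.card_univ, nsmul_eq_mul, ← mul_assoc] at h
  have := mul_right_cancel₀ hS.ne' h
  linarith

theorem secular_equation (hG : IsIndexMaximal α r (fibreGraph f)) (hr : 2 ≤ r) (h0 : 0 ≤ α)
    (h1 : α < 1) (hf : Function.Surjective f) {μ : ℝ}
    (hμ : alphaIndex α (fibreGraph f) = α * Fintype.card V + μ) :
    (∀ i, 0 < μ + fibreCard f i) ∧
      (1 - α) * ∑ i, fibreCard f i / (μ + fibreCard f i) = 1 := by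
  have : Nontrivial (Fin r) := Fin.nontrivial_iff_two_le.2 hr
  have : Nontrivial V := hf.nontrivial
  obtain ⟨x, hnn, hne, hx⟩ := exists_nonneg_eigenvector h1.le (fibreGraph f)
  have hpos := hG.eigenvector_pos hr h0 h1 hx hnn hne
  have hS : 0 < ∑ v, x v := Finset.sum_pos (fun v _ => hpos v) Finset.univ_nonempty
  have hX : ∀ i, 0 < ∑ v, if f v = i then x v else 0 := by
    intro i
    obtain ⟨v, hv⟩ := hf i
    refine Finset.sum_pos' (fun v _ => ?_) ⟨v, Finset.mem_univ _, ?_⟩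
    · split_ifs
      exacts [hnn v, le_rfl]
    · rw [if_pos hv]; exact hpos v
  have hm := one_le_fibreCard hf
  have hclass : ∀ i, (μ + fibreCard f i) * (∑ v, if f v = i then x v else 0)
      = (1 - α) * (∑ v, x v) * fibreCard f i := by
    intro i
    have h := sum_class_eigenvector hx i
    rwa [hμ, add_sub_cancel_left] at h
  have h1' : 0 < 1 - α := by linarith
  have hpos' : ∀ i, 0 < μ + fibreCard f i := by
    intro i
    have : 0 < fibreCard f i := by linarith [hm i]
    have h : 0 < (1 - α) * (∑ v, x v) * fibreCard f i := by positivity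
    rw [← hclass i] at h
    exact pos_of_mul_pos_left h (hX i).le
  refine ⟨hpos', ?_⟩
  have hsum : ∑ v, x v = ∑ i, ∑ v, if f v = i then x v else 0 := by
    rw [Finset.sum_comm]; simp
  have hterm : ∀ i, (∑ v, if f v = i then x v else 0)
      = (1 - α) * (∑ v, x v) * (fibreCard f i / (μ + fibreCard f i)) := by
    intro i
    rw [← mul_div_assoc, ← hclass i, mul_div_cancel_left₀ _ (hpos' i).ne']
  simp only [hterm] at hsum
  rw [← Finset.mul_sum] at hsum
  have h : (∑ v, x v) * ((1 - α) * ∑ i, fibreCard f i / (μ + fibreCard f i)) = (∑ v, x v) * 1 := by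
    linarith
  exact mul_left_cancel₀ hS.ne' h

/-- With S the sum of the test vector 1/(μ + m), `quadForm_fibreGraph` gives an excess S((1 - α)S -
1) over λ times the squared norm; maximality makes it nonpositive. -/
theorem secular_le {G : SimpleGraph V} (hG : IsIndexMaximal α r G) {μ : ℝ}
    (hμ : alphaIndex α G = α * Fintype.card V + μ) {g : V → Fin r}
    (hpos : ∀ i, 0 < μ + fibreCard g i) :
    (1 - α) * ∑ i, fibreCard g i / (μ + fibreCard g i) ≤ 1 := by
  have h := hG.quadForm_le (fibreGraph_cliqueFree g) fun v => 1 / (μ + fibreCard g (g v))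
  rw [quadForm_fibreGraph α μ g (fun v => hpos _), hμ] at h
  have hS : 0 < ∑ v, 1 / (μ + fibreCard g (g v)) :=
    Finset.sum_pos (fun v _ => one_div_pos.2 (hpos _)) Finset.univ_nonempty
  have hle : (1 - α) * (∑ v, 1 / (μ + fibreCard g (g v))) - 1 ≤ 0 := by
    by_contra! hc
    linarith [mul_pos hS hc]
  rw [sum_comp_eq_sum_fibreCard g fun i => 1 / (μ + fibreCard g i)] at hle
  simp only [mul_one_div] at hle
  linarith

/-- Moving a vertex from the class of `u` to the class `j` does not increase the index. -/
theorem move_le (hG : IsIndexMaximal α r (fibreGraph f)) (hr : 2 ≤ r) (h0 : 0 ≤ α)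
    (h1 : α < 1) (hf : Function.Surjective f) {μ : ℝ}
    (hμ : alphaIndex α (fibreGraph f) = α * Fintype.card V + μ) {i j : Fin r} (hij : i ≠ j)
    (hi : 0 < μ + fibreCard f i - 1) :
    μ * ((μ + fibreCard f i) * (μ + fibreCard f i - 1))
      ≤ μ * ((μ + fibreCard f j) * (μ + fibreCard f j + 1)) := by
  obtain ⟨hpos, hsec⟩ := hG.secular_equation hr h0 h1 hf hμ
  obtain ⟨u, rfl⟩ := hf i
  have hpos' : ∀ k, 0 < μ + fibreCard (Function.update f u j) k := by
    intro k
    rw [fibreCard_update]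
    have := hpos k
    split_ifs with h2 h3 h3
    · linarith
    · linarith
    · subst h3; linarith
    · linarith
  have hle := (hG.secular_le hμ hpos').trans_eq hsec.symm
  have hle := le_of_mul_le_mul_left hle (by linarith : (0 : ℝ) < 1 - α)
  rw [← sub_nonpos, ← Finset.sum_sub_distrib, Finset.sum_eq_add (f u) j hij] at hle
  · simp only [fibreCard_update, if_true, if_neg hij, if_neg hij.symm] at hle
    have hi' := hpos (f u)
    have hj' := hpos j
    generalize fibreCard f (f u) = a at *
    generalize fibreCard f j = b at *
    have ha : 0 < μ + (a - 1) := by linarith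
    have hb : 0 < μ + (b + 1) := by linarith
    have e : (a + 0 - 1) / (μ + (a + 0 - 1)) - a / (μ + a)
        + ((b + 1 - 0) / (μ + (b + 1 - 0)) - b / (μ + b))
        = (μ * ((μ + a) * (μ + a - 1)) - μ * ((μ + b) * (μ + b + 1)))
          / ((μ + a) * (μ + (a - 1)) * ((μ + b) * (μ + (b + 1)))) := by
      rw [add_zero, sub_zero]
      field_simp
      ring
    rw [e] at hle
    have hD : 0 < (μ + a) * (μ + (a - 1)) * ((μ + b) * (μ + (b + 1))) := by positivity
    rw [div_nonpos_iff] at hle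
    rcases hle with h | h
    · linarith [h.2]
    · linarith [h.1]
  · rintro k - ⟨hk1, hk2⟩
    rw [fibreCard_update, if_neg hk1.symm, if_neg hk2.symm, add_zero, sub_zero, sub_self]
  · simp
  · simp

end IsIndexMaximal

end AlphaTuran

/-! ### Recognizing the extremal graphs. -/

namespace AlphaTuran

theorem isCompletePartite_iff {V : Type*} {G : SimpleGraph V} {r : ℕ} :
    IsCompletePartite G r ↔ ∃ f : V → Fin r, Function.Surjective f ∧ G = fibreGraph f := by
  refine exists_congr fun f => and_congr_right fun _ => ⟨fun h => ?_, ?_⟩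
  · ext u v
    rw [h, fibreGraph_adj]
  · rintro rfl u v
    rfl

theorem nonempty_iso_turanGraph_of_balanced {V : Type*} [Fintype V] [DecidableEq V] {r : ℕ}
    {f : V → Fin r} (hf : Function.Surjective f)
    (hb : ∀ i j, #{v | f v = i} ≤ #{v | f v = j} + 1) :
    Nonempty (fibreGraph f ≃g SimpleGraph.turanGraph (Fintype.card V) r) := by
  classical
  let P : Finpartition (univ : Finset V) := Finpartition.ofSetoid (Setoid.ker f)
  have hpart : ∀ a b, P.part a = P.part b ↔ f a = f b := by
    intro a b
    rw [← P.mem_part_iff_part_eq_part (Finset.mem_univ _) (Finset.mem_univ _),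
      Finpartition.mem_part_ofSetoid_iff_rel, Setoid.ker_def, eq_comm]
  have hmem : ∀ s ∈ P.parts, ∃ i, s = ({v | f v = i} : Finset V) := by
    intro s hs
    obtain ⟨a, ha⟩ := P.nonempty_of_mem_parts hs
    refine ⟨f a, ?_⟩
    rw [← P.part_eq_of_mem hs ha]
    ext b
    rw [Finpartition.mem_part_ofSetoid_iff_rel, Setoid.ker_def, eq_comm]
    simp
  have hparts : P.parts = univ.image fun i => ({v | f v = i} : Finset V) := by
    ext s
    rw [Finset.mem_image]
    refine ⟨fun hs => ?_, ?_⟩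
    · obtain ⟨i, rfl⟩ := hmem s hs
      exact ⟨i, Finset.mem_univ _, rfl⟩
    · rintro ⟨i, -, rfl⟩
      obtain ⟨a, rfl⟩ := hf i
      obtain ⟨j, hj⟩ := hmem _ (P.part_mem.2 (Finset.mem_univ a))
      have ha : a ∈ P.part a := P.mem_part (Finset.mem_univ a)
      rw [hj, Finset.mem_filter] at ha
      rw [ha.2, ← hj]
      exact P.part_mem.2 (Finset.mem_univ a)
  have hcard : #P.parts = r := by
    rw [hparts, Finset.card_image_of_injective, Finset.card_univ, Fintype.card_fin]
    intro i j hij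
    obtain ⟨a, rfl⟩ := hf i
    have : a ∈ ({v | f v = j} : Finset V) := by
      rw [← show _ = ({v | f v = j} : Finset V) from hij]; simp
    simpa using this
  have hP : P.IsEquipartition := by
    intro s t hs ht
    obtain ⟨i, rfl⟩ := hmem s hs
    obtain ⟨j, rfl⟩ := hmem t ht
    exact hb _ _
  -- An equipartition can be numbered so that parts are residue classes modulo the number of parts,
  -- as in the Turán graph.
  obtain ⟨e, he⟩ := hP.exists_partPreservingEquiv
  refine ⟨⟨(Equiv.subtypeUnivEquiv Finset.mem_univ).symm.trans e, fun {a b} => ?_⟩⟩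
  have h := he ⟨a, Finset.mem_univ a⟩ ⟨b, Finset.mem_univ b⟩
  rw [hpart, hcard] at h
  rw [SimpleGraph.turanGraph_adj, fibreGraph_adj, Ne, Ne, h]
  rfl

theorem nonempty_iso_splitGraph {V : Type*} [Fintype V] [DecidableEq V] {r : ℕ}
    {f : V → Fin r} (hf : Function.Surjective f) (i : Fin r)
    (hb : ∀ j, j ≠ i → #{v | f v = j} ≤ 1) :
    Nonempty (fibreGraph f ≃g splitGraph (Fintype.card V) (r - 1)) := by
  classical
  have hinj : ∀ u v, f u ≠ i → f u = f v → u = v := by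
    intro u v hu huv
    exact Finset.card_le_one.1 (hb _ hu) u (by simp) v (by simp [huv])
  have hle : r ≤ Fintype.card V := by simpa using Fintype.card_le_of_surjective f hf
  have hcard : #{v | f v ≠ i} = r - 1 := by
    have himg : ({v | f v ≠ i} : Finset V).image f = univ.erase i := by
      ext j
      obtain ⟨v, rfl⟩ := hf j
      simp only [Finset.mem_image, Finset.mem_filter, Finset.mem_univ, true_and,
        Finset.mem_erase, and_true]
      exact ⟨fun ⟨w, hw, h⟩ => h ▸ hw, fun h => ⟨v, h, rfl⟩⟩
    rw [← Finset.card_image_of_injOn (f := f), himg, Finset.card_erase_of_mem (Finset.mem_univ _),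
      Finset.card_univ, Fintype.card_fin]
    intro u hu v _ huv
    exact hinj u v (by simpa using hu) huv
  let e₀ := Fintype.equivFin V
  -- The `r - 1` vertices outside class `i` go to the dominating vertices; the bijection then
  -- extends to all of `Fin n`.
  let e₁ : {x // f (e₀.symm x) ≠ i} ≃ {x : Fin (Fintype.card V) // (x : ℕ) < r - 1} :=
    Fintype.equivOfCardEq (by
      rw [Fintype.card_congr (e₀.symm.subtypeEquiv (q := fun v => f v ≠ i) fun _ => Iff.rfl),
        Fintype.card_subtype, hcard, Fintype.card_subtype, Fin.card_filter_val_lt]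
      omega)
  let e := e₀.trans e₁.extendSubtype
  have he : ∀ v, ((e v : Fin _) : ℕ) < r - 1 ↔ f v ≠ i := by
    intro v
    by_cases hv : f v ≠ i
    · exact iff_of_true (e₁.extendSubtype_mem (e₀ v) (by simpa using hv)) hv
    · exact iff_of_false (e₁.extendSubtype_not_mem (e₀ v) (by simpa using hv)) hv
  refine ⟨⟨e, fun {a b} => ?_⟩⟩
  change (e a ≠ e b ∧ (((e a : Fin _) : ℕ) < r - 1 ∨ ((e b : Fin _) : ℕ) < r - 1)) ↔ _
  rw [he, he, fibreGraph_adj, e.injective.ne_iff]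
  constructor
  · rintro ⟨hab, h | h⟩ hfab
    · exact hab (hinj a b h hfab)
    · exact hab (hinj b a h hfab.symm).symm
  · intro h
    refine ⟨fun hab => h (hab ▸ rfl), ?_⟩
    by_contra! hc
    exact h (hc.1.trans hc.2.symm)

theorem fibreGraph_eq_top {V ι : Type*} {f : V → ι} (hf : Function.Injective f) :
    fibreGraph f = ⊤ := by
  ext u v
  rw [fibreGraph_adj, SimpleGraph.top_adj, hf.ne_iff]

theorem splitGraph_eq_top {n r : ℕ} (h : n ≤ r) : splitGraph n (r - 1) = ⊤ := by
  ext u v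
  rw [SimpleGraph.top_adj]
  refine ⟨fun h => h.1, fun huv => ⟨huv, ?_⟩⟩
  have := Fin.val_ne_of_ne huv
  omega

variable {V : Type*} [Fintype V] [DecidableEq V]

/-! ### The sign of μ decides the shape of the partition. -/

namespace IsIndexMaximal

variable [Nonempty V] {α : ℝ} {r : ℕ} {G : SimpleGraph V}

theorem nonempty_iso_turanGraph (hG : IsIndexMaximal α r G) (hr : 2 ≤ r) (h0 : 0 ≤ α)
    (h1 : α < 1 - 1 / (r : ℝ)) :
    Nonempty (G ≃g SimpleGraph.turanGraph (Fintype.card V) r) := by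
  have hr0 : (0 : ℝ) < r := by positivity
  have h1' : α < 1 := by
    have : 0 < 1 / (r : ℝ) := by positivity
    linarith
  obtain ⟨f, rfl, hf | ⟨hf, hlt⟩⟩ := hG.exists_eq_fibreGraph hr h0 h1'
  · refine nonempty_iso_turanGraph_of_balanced hf fun i j => ?_
    obtain ⟨μ, hμ⟩ : ∃ μ, alphaIndex α (fibreGraph f) = α * Fintype.card V + μ :=
      ⟨_, (add_sub_cancel _ _).symm⟩
    obtain ⟨hpos, hsec⟩ := hG.secular_equation hr h0 h1' hf hμ
    -- If μ ≤ 0, every quotient is at least 1, so (1 - α)r ≤ 1.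
    have hμ0 : 0 < μ := by
      by_contra! hμ0
      have hsum : ∑ _i : Fin r, (1 : ℝ) ≤ ∑ i, fibreCard f i / (μ + fibreCard f i) :=
        Finset.sum_le_sum fun i _ => by rw [one_le_div (hpos i)]; linarith
      rw [Finset.sum_const, Finset.card_univ, Fintype.card_fin, nsmul_eq_mul, mul_one] at hsum
      have h2 := mul_le_mul_of_nonneg_left hsum (by linarith : 0 ≤ 1 - α)
      have h3 : 1 / (r : ℝ) * r < (1 - α) * r := mul_lt_mul_of_pos_right (by linarith) hr0
      rw [one_div_mul_cancel hr0.ne'] at h3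
      linarith
    by_contra! hc
    have hc' : fibreCard f j + 2 ≤ fibreCard f i := by
      rw [fibreCard_eq, fibreCard_eq]
      exact_mod_cast hc
    have hij : i ≠ j := by
      rintro rfl
      linarith
    have hj := one_le_fibreCard hf j
    have h := le_of_mul_le_mul_left
      (hG.move_le hr h0 h1' hf hμ hij (by linarith)) hμ0
    have : (μ + fibreCard f j) * (μ + fibreCard f j + 1)
        < (μ + fibreCard f i) * (μ + fibreCard f i - 1) :=
      mul_lt_mul (by linarith) (by linarith) (by linarith) (by linarith)
    linarith
  · rw [fibreGraph_eq_top hf, SimpleGraph.turanGraph_eq_top.2 (Or.inr hlt.le)]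
    exact ⟨SimpleGraph.Iso.completeGraph (Fintype.equivFin V)⟩

theorem nonempty_iso_splitGraph (hG : IsIndexMaximal α r G) (hr : 2 ≤ r)
    (h0 : 1 - 1 / (r : ℝ) < α) (h1 : α < 1) :
    Nonempty (G ≃g splitGraph (Fintype.card V) (r - 1)) := by
  have hr0 : (0 : ℝ) < r := by positivity
  have hα : 0 ≤ α := by
    have : 1 / (r : ℝ) ≤ 1 := by
      rw [div_le_one hr0]
      exact_mod_cast (by omega : 1 ≤ r)
    linarith
  obtain ⟨f, rfl, hf | ⟨hf, hlt⟩⟩ := hG.exists_eq_fibreGraph hr hα h1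
  · obtain ⟨μ, hμ⟩ : ∃ μ, alphaIndex α (fibreGraph f) = α * Fintype.card V + μ :=
      ⟨_, (add_sub_cancel _ _).symm⟩
    obtain ⟨hpos, hsec⟩ := hG.secular_equation hr hα h1 hf hμ
    have hnt : Nontrivial (Fin r) := Fin.nontrivial_iff_two_le.2 hr
    have : Nontrivial V := hf.nontrivial
    -- This keeps μ + m - 1 positive for a class of size m ≥ 2, as `move_le` requires.
    have hμ1 : -1 < μ := by
      have := hG.card_mul_le hr
      linarith
    have hμ0 : μ < 0 := by
      by_contra! hμ0
      have hsum : ∑ i, fibreCard f i / (μ + fibreCard f i) ≤ ∑ _i : Fin r, (1 : ℝ) :=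
        Finset.sum_le_sum fun i _ => by rw [div_le_one (hpos i)]; linarith
      rw [Finset.sum_const, Finset.card_univ, Fintype.card_fin, nsmul_eq_mul, mul_one] at hsum
      have h2 := mul_le_mul_of_nonneg_left hsum (by linarith : 0 ≤ 1 - α)
      have h3 : (1 - α) * r < 1 / (r : ℝ) * r := mul_lt_mul_of_pos_right (by linarith) hr0
      rw [one_div_mul_cancel hr0.ne'] at h3
      linarith
    obtain ⟨i, hi⟩ := Finite.exists_max (fibreCard f)
    refine AlphaTuran.nonempty_iso_splitGraph hf i fun j hj => ?_
    by_contra! hc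
    have hc' : 2 ≤ fibreCard f j := by
      rw [fibreCard_eq]
      exact_mod_cast hc
    have h := hG.move_le hr hα h1 hf hμ hj (by linarith)
    have hij := hi j
    have : (μ + fibreCard f j) * (μ + fibreCard f j - 1)
        < (μ + fibreCard f i) * (μ + fibreCard f i + 1) :=
      mul_lt_mul' (by linarith) (by linarith) (by linarith) (by linarith)
    linarith [mul_lt_mul_of_neg_left this hμ0]
  · rw [fibreGraph_eq_top hf, splitGraph_eq_top hlt.le]
    exact ⟨SimpleGraph.Iso.completeGraph (Fintype.equivFin V)⟩

theorem alphaIndex_eq_of_surjective {f : V → Fin r} (hG : IsIndexMaximal α r (fibreGraph f))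
    (hr : 2 ≤ r) (hα : α = 1 - 1 / (r : ℝ)) (hf : Function.Surjective f) :
    alphaIndex α (fibreGraph f) = α * Fintype.card V := by
  have hr0 : (0 : ℝ) < r := by positivity
  have hr1 : 1 / (r : ℝ) ≤ 1 := by
    rw [div_le_one hr0]
    exact_mod_cast (by omega : 1 ≤ r)
  have hr2 : 0 < 1 / (r : ℝ) := by positivity
  obtain ⟨μ, hμ⟩ : ∃ μ, alphaIndex α (fibreGraph f) = α * Fintype.card V + μ :=
    ⟨_, (add_sub_cancel _ _).symm⟩
  obtain ⟨hpos, hsec⟩ := hG.secular_equation hr (by linarith) (by linarith) hf hμ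
  have : Nonempty (Fin r) := ⟨⟨0, by omega⟩⟩
  have hsum : ∑ i, fibreCard f i / (μ + fibreCard f i) = ∑ _i : Fin r, (1 : ℝ) := by
    rw [Finset.sum_const, Finset.card_univ, Fintype.card_fin, nsmul_eq_mul, mul_one]
    rw [hα, sub_sub_cancel, one_div, inv_mul_eq_one₀ hr0.ne'] at hsec
    exact hsec.symm
  rcases lt_trichotomy μ 0 with h | h | h
  · refine absurd hsum (ne_of_gt (Finset.sum_lt_sum_of_nonempty Finset.univ_nonempty fun i _ => ?_))
    rw [one_lt_div (hpos i)]; linarith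
  · rw [hμ, h, add_zero]
  · refine absurd hsum (ne_of_lt (Finset.sum_lt_sum_of_nonempty Finset.univ_nonempty fun i _ => ?_))
    rw [div_lt_one (hpos i)]; linarith

end IsIndexMaximal

/-- The test vector 1/m (κ = 0) has sum r, so the excess in `quadForm_fibreGraph` vanishes when (1 -
α)r = 1, whatever the class sizes. -/
theorem card_mul_le_alphaIndex_of_surjective [Nonempty V] {α : ℝ} {r : ℕ} {f : V → Fin r}
    (hα : α = 1 - 1 / (r : ℝ)) (hf : Function.Surjective f) :
    α * Fintype.card V ≤ alphaIndex α (fibreGraph f) := by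
  have hm := one_le_fibreCard hf
  have hpos : ∀ v, 0 < 0 + fibreCard f (f v) := fun v => by linarith [hm (f v)]
  have hr0 : (r : ℝ) ≠ 0 := by
    rintro h
    obtain ⟨v⟩ := ‹Nonempty V›
    have := (f v).pos
    rw [Nat.cast_eq_zero.1 h] at this
    exact this.false
  have h := quadForm_le α (fibreGraph f) fun v => 1 / (0 + fibreCard f (f v))
  have hS : ∑ v, 1 / (0 + fibreCard f (f v)) = r := by
    rw [sum_comp_eq_sum_fibreCard f fun i => 1 / (0 + fibreCard f i)]
    have : ∀ i, fibreCard f i * (1 / (0 + fibreCard f i)) = 1 := fun i => by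
      rw [zero_add, mul_one_div_cancel]
      linarith [hm i]
    simp only [this, Finset.sum_const, Finset.card_univ, Fintype.card_fin, nsmul_eq_mul, mul_one]
  rw [quadForm_fibreGraph α 0 f hpos, hS, hα, sub_sub_cancel, one_div_mul_cancel hr0, sub_self,
    mul_zero, add_zero, add_zero, ← hα] at h
  refine le_of_mul_le_mul_right h ?_
  exact Finset.sum_pos (fun v _ => pow_pos (one_div_pos.2 (hpos v)) 2) Finset.univ_nonempty

/-- If every index-maximal graph is isomorphic to `T`, then `T` is the unique graph of largest
index. -/
theorem alphaIndex_lt_of_forall_iso [Nonempty V] {W : Type*} [Fintype W] [DecidableEq W]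
    [Nonempty W] {α : ℝ} {r : ℕ} (hr : 1 ≤ r) (h1 : α ≤ 1) {G : SimpleGraph V}
    {T : SimpleGraph W} (hG : G.CliqueFree (r + 1))
    (hT : ∀ H : SimpleGraph V, IsIndexMaximal α r H → Nonempty (H ≃g T))
    (hne : ¬ Nonempty (G ≃g T)) : alphaIndex α G < alphaIndex α T := by
  obtain ⟨r, rfl⟩ := Nat.exists_eq_add_of_le' hr
  obtain ⟨H, hH⟩ := exists_isIndexMaximal (V := V) α r
  obtain ⟨e⟩ := hT H hH
  rw [← alphaIndex_eq_of_iso h1 e]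
  -- A graph whose index ties with that of `H` is itself index-maximal.
  refine (hH.2 G hG).lt_of_ne fun heq => hne (hT G ⟨hG, fun K hK => ?_⟩)
  rw [heq]
  exact hH.2 K hK

theorem alphaIndex_le_and_eq_iff [Nonempty V] {α : ℝ} {r : ℕ} (hr : 2 ≤ r)
    (hα : α = 1 - 1 / (r : ℝ)) {G : SimpleGraph V} (hG : G.CliqueFree (r + 1)) :
    alphaIndex α G ≤ α * Fintype.card V ∧
      (alphaIndex α G = α * Fintype.card V ↔ IsCompletePartite G r) := by
  have hr0 : (0 : ℝ) < r := by positivity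
  have hr1 : 1 / (r : ℝ) ≤ 1 := by
    rw [div_le_one hr0]
    exact_mod_cast (by omega : 1 ≤ r)
  have hr2 : 0 < 1 / (r : ℝ) := by positivity
  have hmax : ∀ H : SimpleGraph V, IsIndexMaximal α r H →
      (alphaIndex α H = α * Fintype.card V ∧ IsCompletePartite H r) ∨
        alphaIndex α H < α * Fintype.card V := by
    intro H hH
    obtain ⟨f, rfl, hf | ⟨hf, hlt⟩⟩ := hH.exists_eq_fibreGraph hr (by linarith) (by linarith)
    · exact Or.inl ⟨hH.alphaIndex_eq_of_surjective hr hα hf,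
        isCompletePartite_iff.2 ⟨f, hf, rfl⟩⟩
    -- Here the graph is complete on n < r vertices, and n - 1 < (1 - 1/r)n.
    · right
      rw [IsIndexMaximal.alphaIndex_of_injective hf (by linarith), hα, sub_mul, one_mul]
      have : 1 / (r : ℝ) * Fintype.card V < 1 / (r : ℝ) * r :=
        mul_lt_mul_of_pos_left (by exact_mod_cast hlt) hr2
      rw [one_div_mul_cancel hr0.ne'] at this
      linarith
  obtain ⟨s, hs⟩ := Nat.exists_eq_add_of_le' (by omega : 1 ≤ r)
  obtain ⟨H, hH⟩ := exists_isIndexMaximal (V := V) α s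
  rw [← hs] at hH
  have hle : alphaIndex α H ≤ α * Fintype.card V := by
    rcases hmax H hH with h | h
    exacts [h.1.le, h.le]
  have hGle := (hH.2 G hG).trans hle
  refine ⟨hGle, fun heq => ?_, fun hp => hGle.antisymm ?_⟩
  · have hGmax : IsIndexMaximal α r G :=
      ⟨hG, fun K hK => ((hH.2 K hK).trans hle).trans_eq heq.symm⟩
    rcases hmax G hGmax with h | h
    exacts [h.2, absurd heq h.ne]
  · obtain ⟨f, hf, rfl⟩ := isCompletePartite_iff.1 hp
    exact card_mul_le_alphaIndex_of_surjective hα hf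

end AlphaTuran

theorem mainTheorem1 {V : Type*} [Fintype V] [DecidableEq V] (G : SimpleGraph V)
    [DecidableRel G.Adj] (n r : ℕ) (hn : 1 ≤ n) (hr : 2 ≤ r) (hV : Fintype.card V = n)
    (hG : G.CliqueFree (r + 1)) (α : ℝ) :
    (0 ≤ α → α < 1 - 1 / (r : ℝ) →
      ¬ Nonempty (G ≃g SimpleGraph.turanGraph n r) →
        AlphaTuran.largestEigenvalue (AlphaTuran.alphaMatrix α G) <
          AlphaTuran.largestEigenvalue
            (AlphaTuran.alphaMatrix α (SimpleGraph.turanGraph n r))) ∧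
    (1 - 1 / (r : ℝ) < α → α < 1 →
      ¬ Nonempty (G ≃g AlphaTuran.splitGraph n (r - 1)) →
        AlphaTuran.largestEigenvalue (AlphaTuran.alphaMatrix α G) <
          AlphaTuran.largestEigenvalue
            (AlphaTuran.alphaMatrix α (AlphaTuran.splitGraph n (r - 1)))) ∧
    (α = 1 - 1 / (r : ℝ) →
      AlphaTuran.largestEigenvalue (AlphaTuran.alphaMatrix α G) ≤ (1 - 1 / (r : ℝ)) * n ∧
      (AlphaTuran.largestEigenvalue (AlphaTuran.alphaMatrix α G) = (1 - 1 / (r : ℝ)) * n ↔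
        AlphaTuran.IsCompletePartite G r)) := by
  subst hV
  have : Nonempty V := Fintype.card_pos_iff.1 hn
  have : Nonempty (Fin (Fintype.card V)) := ⟨⟨0, hn⟩⟩
  simp only [AlphaTuran.largestEigenvalue_alphaMatrix]
  refine ⟨fun h0 h1 hne => ?_, fun h0 h1 hne => ?_, fun hα => ?_⟩
  · have hr2 : 0 < 1 / (r : ℝ) := by positivity
    exact AlphaTuran.alphaIndex_lt_of_forall_iso (by omega) (by linarith) hG
      (fun H hH => hH.nonempty_iso_turanGraph hr h0 h1) hne
  · exact AlphaTuran.alphaIndex_lt_of_forall_iso (by omega) h1.le hG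
      (fun H hH => hH.nonempty_iso_splitGraph hr h0 h1) hne
  · rw [← hα]
    exact AlphaTuran.alphaIndex_le_and_eq_iff hr hα hG
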